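/- Let $p$ be a prime and let $G$ be a $p$-adic analytic group, i.e. a topological group which carries the structure of a (finite-dimensional) analytic manifold over $\mathbb{Q}_p$ for which multiplication and inversion are analytic maps. Let $k$ be a field of positive characteristic (not necessarily equal to $p$). A representation of $G$ on a $k$-vector space $V$ (a homomorphism from the abstract group $G$ to $\mathrm{GL}_k(V)$) is called *smooth* if the action map $G\times V\to V$ is continuous when $V$ carries the discrete topology. For an arbitrary representation $V$ of $G$ over $k$, the smooth part of $V$ is the subrepresentation $$V^{\mathrm{sm}}=\bigcup_{K} V^K,\qquad V^K=\{v\in V : xv=v \text{ for all } x\in K\},$$ where $K$ runs through the compact open subgroups of $G$. A morphism $f\colon V\to W$ of representations restricts to a morphism $f^{\mathrm{sm}}\colon V^{\mathrm{sm}}\to W^{\mathrm{sm}}$. Let $f\colon V\to W$ be a surjective morphism of representations of $G$ over $k$ such that the representation $\ker(f)$ is smooth. Then $f^{\mathrm{sm}}\colon V^{\mathrm{sm}}\to W^{\mathrm{sm}}$ is surjective. -/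

import Mathlib

open scoped Manifold ContDiff

/-- A `p`-adic analytic group has a compact open subgroup. -/
theorem LieGroup.exists_isOpen_isCompact_subgroup {p : ℕ} [Fact p.Prime] {d : ℕ}
    {G : Type*} [Group G] [TopologicalSpace G] [IsTopologicalGroup G]
    [ChartedSpace (Fin d → ℚ_[p]) G] [LieGroup 𝓘(ℚ_[p], Fin d → ℚ_[p]) ω G] :
    ∃ K : Subgroup G, IsOpen (K : Set G) ∧ IsCompact (K : Set G) := by
  let e := chartAt (Fin d → ℚ_[p]) (1 : G)
  have h1 : (1 : G) ∈ e.source := mem_chart_source _ _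
  obtain ⟨r, hr, hre⟩ := Metric.isOpen_iff.1 e.open_target _ (e.map_source h1)
  let B : Set (Fin d → ℚ_[p]) := Metric.closedBall (e 1) (r / 2)
  have hBt : B ⊆ e.target := (Metric.closedBall_subset_ball (by linarith)).trans hre
  have hBo : IsOpen B := IsUltrametricDist.isOpen_closedBall _ (by positivity)
  have hBc : IsCompact B := isCompact_closedBall _ _
  let U : Set G := e.symm '' B
  have hU1 : (1 : G) ∈ U := ⟨e 1, Metric.mem_closedBall_self (by positivity), e.left_inv h1⟩
  have hUo : IsOpen U := e.isOpen_image_symm_of_subset_target hBo hBt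
  have hUc : IsCompact U := hBc.image_of_continuousOn (e.continuousOn_symm.mono hBt)
  obtain ⟨S, hS, hSU⟩ := compact_open_separated_mul_left hUc hUo subset_rfl
  let H : Subgroup G := Subgroup.closure (S ∩ S⁻¹)
  have hT : S ∩ S⁻¹ ∈ nhds (1 : G) := Filter.inter_mem hS (inv_mem_nhds_one G hS)
  have hHo : IsOpen (H : Set G) :=
    Subgroup.isOpen_of_mem_nhds H (Filter.mem_of_superset hT Subgroup.subset_closure)
  have hHU : ∀ x ∈ H, ∀ u ∈ U, x * u ∈ U := by
    intro x hx
    induction hx using Subgroup.closure_induction'' with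
    | mem x hx => exact fun u hu => hSU (Set.mul_mem_mul hx.1 hu)
    | inv_mem x hx => exact fun u hu => hSU (Set.mul_mem_mul hx.2 hu)
    | one => exact fun u hu => by rwa [one_mul]
    | mul x y _ _ hx hy => exact fun u hu => by rw [mul_assoc]; exact hx _ (hy _ hu)
  refine ⟨H, hHo, hUc.of_isClosed_subset (Subgroup.isClosed_of_isOpen H hHo) fun x hx => ?_⟩
  simpa using hHU x hx 1 hU1

namespace Representation

/-- A representation `ρ` of a topological group `G` on `V` is smooth if the action map
`G × V → V` is continuous when `V` carries the discrete topology. -/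
def IsSmooth {k G V : Type*} [CommRing k] [Group G] [TopologicalSpace G]
    [AddCommGroup V] [Module k V] (ρ : Representation k G V) : Prop :=
  letI : TopologicalSpace V := ⊥
  Continuous fun x : G × V => ρ x.1 x.2

/-- The submodule `V^K` of vectors fixed by all elements of the subgroup `K`. -/
def fixedBy {k G V : Type*} [CommRing k] [Group G] [AddCommGroup V] [Module k V]
    (ρ : Representation k G V) (K : Subgroup G) : Submodule k V where
  carrier := {v | ∀ x ∈ K, ρ x v = v}
  add_mem' := fun ha hb x hx => by rw [map_add, ha x hx, hb x hx]
  zero_mem' := fun x _ => map_zero (ρ x)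
  smul_mem' := fun c v hv x hx => by rw [map_smul, hv x hx]

/-- The smooth part `V^sm`: the sum of the subspaces `V^K`, with `K` running through the compact
open subgroups of `G`. As soon as `G` has a compact open subgroup, this is the union of the `V^K`, see
`Representation.coe_smoothPart`; every `p`-adic analytic group has one, see
`LieGroup.exists_isOpen_isCompact_subgroup`. -/
def smoothPart {k G V : Type*} [CommRing k] [Group G] [TopologicalSpace G] [IsTopologicalGroup G]
    [AddCommGroup V] [Module k V] (ρ : Representation k G V) : Subrepresentation ρ where
  toSubmodule := ⨆ (K : Subgroup G) (_ : IsOpen (K : Set G) ∧ IsCompact (K : Set G)), ρ.fixedBy K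
  apply_mem_toSubmodule := by
    intro g
    suffices h : (⨆ (K : Subgroup G) (_ : IsOpen (K : Set G) ∧ IsCompact (K : Set G)),
        ρ.fixedBy K) ≤ Submodule.comap (ρ g)
          (⨆ (K : Subgroup G) (_ : IsOpen (K : Set G) ∧ IsCompact (K : Set G)), ρ.fixedBy K) from
      fun v hv => h hv
    refine iSup₂_le fun K hK v hv => ?_
    let φ : G ≃ₜ G := (Homeomorph.mulLeft g⁻¹).trans (Homeomorph.mulRight g)
    let L : Subgroup G := K.comap (MulAut.conj g⁻¹).toMonoidHom
    have hL : (L : Set G) = φ ⁻¹' (K : Set G) := by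
      ext x
      simp [L, φ]
    have hL' : IsOpen (L : Set G) ∧ IsCompact (L : Set G) := by
      rw [hL]
      exact ⟨hK.1.preimage φ.continuous, φ.isCompact_preimage.2 hK.2⟩
    refine Submodule.mem_iSup_of_mem L (Submodule.mem_iSup_of_mem hL' fun x hx => ?_)
    have h1 : g⁻¹ * x * g ∈ K := by simpa [L] using hx
    have h2 := congrArg (ρ g) (hv _ h1)
    rw [← Module.End.mul_apply, ← map_mul] at h2
    rw [← Module.End.mul_apply, ← map_mul]
    rwa [show g * (g⁻¹ * x * g) = x * g by group] at h2

/-- The smooth part is the union of the subspaces `V^K`, `K` a compact open subgroup of `G`. -/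
theorem coe_smoothPart {k G V : Type*} [CommRing k] [Group G] [TopologicalSpace G]
    [IsTopologicalGroup G] [AddCommGroup V] [Module k V] (ρ : Representation k G V)
    (hG : ∃ K : Subgroup G, IsOpen (K : Set G) ∧ IsCompact (K : Set G)) :
    (ρ.smoothPart.toSubmodule : Set V) =
      ⋃ (K : Subgroup G) (_ : IsOpen (K : Set G) ∧ IsCompact (K : Set G)),
        {v | ∀ x ∈ K, ρ x v = v} := by
  obtain ⟨K₀, hK₀⟩ := hG
  have : Nonempty {K : Subgroup G // IsOpen (K : Set G) ∧ IsCompact (K : Set G)} := ⟨⟨K₀, hK₀⟩⟩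
  have hdir : Directed (· ≤ ·) fun K : {K : Subgroup G // IsOpen (K : Set G) ∧
      IsCompact (K : Set G)} => ρ.fixedBy K.1 := by
    rintro ⟨K, hK⟩ ⟨L, hL⟩
    refine ⟨⟨K ⊓ L, ?_, ?_⟩, fun v hv x hx => hv x hx.1, fun v hv x hx => hv x hx.2⟩
    · exact hK.1.inter hL.1
    · exact hK.2.inter_right (Subgroup.isClosed_of_isOpen L hL.1)
  ext v
  have : ρ.smoothPart.toSubmodule = ⨆ K : {K : Subgroup G // IsOpen (K : Set G) ∧
      IsCompact (K : Set G)}, ρ.fixedBy K.1 := by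
    rw [iSup_subtype]; rfl
  rw [this, SetLike.mem_coe, Submodule.mem_iSup_of_directed _ hdir]
  simp only [Set.mem_iUnion, Subtype.exists]
  rfl

/-- The morphism `f^sm : V^sm → W^sm` induced by a morphism `f : V → W` of representations. -/
def IntertwiningMap.smoothMap {k G V W : Type*} [CommRing k] [Group G] [TopologicalSpace G]
    [IsTopologicalGroup G] [AddCommGroup V] [Module k V] [AddCommGroup W] [Module k W]
    {ρ : Representation k G V} {σ : Representation k G W} (f : IntertwiningMap ρ σ) :
    IntertwiningMap ρ.smoothPart.toRepresentation σ.smoothPart.toRepresentation where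
  toLinearMap := f.toLinearMap.restrict (p := ρ.smoothPart.toSubmodule)
    (q := σ.smoothPart.toSubmodule) <| by
      suffices h : ρ.smoothPart.toSubmodule ≤
          Submodule.comap f.toLinearMap σ.smoothPart.toSubmodule from fun v hv => h hv
      refine iSup₂_le fun K hK v hv => ?_
      refine Submodule.mem_iSup_of_mem K (Submodule.mem_iSup_of_mem hK fun x hx => ?_)
      change σ x (f v) = f v
      rw [← IntertwiningMap.isIntertwining, hv x hx]
  isIntertwining' := fun g => LinearMap.ext fun v => Subtype.ext (IntertwiningMap.isIntertwining ρ σ f g v)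

end Representation

/-! Lift a `K`-fixed `w` to `v`. For `g ∈ K` the vector `gv - v` lies in the smooth kernel, so its
stabilizer is open and hence closed. It remains to show that the stabilizer `Z` of `v` itself is
open; then `v` is fixed by the compact open subgroup `K ⊓ Z`.

Algebra: if `g` fixes `gv - v`, then `g ^ n v - v = n (gv - v)`, which vanishes for `n = m`, the
characteristic. Combined with a symmetry for commuting elements, this shows that each `x ∈ K` has a
power whose closed procyclic group lies in `Z` (`exists_closure_zpowers_le_vectorStabilizer`). The
closure matters, because `Z` is not known to be closed.

Analysis: a product of `d` closed procyclic groups, one for each coordinate direction, contains a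
neighbourhood of `1` (`NearlyAdditive.exists_forall_norm_le_mem`). Instead of Lie theory, this uses
only that multiplication in a chart is strictly differentiable with derivative the addition,
together with successive approximation. -/

namespace Representation

/-! ### Stabilizers and the differences `gv - v` -/

/-- The stabilizer of a vector of a representation. -/
def vectorStabilizer {k G V : Type*} [CommRing k] [Group G] [AddCommGroup V] [Module k V]
    (ρ : Representation k G V) (v : V) : Subgroup G where
  carrier := {g | ρ g v = v}
  one_mem' := by simp
  mul_mem' := fun {a b} ha hb => by
    change ρ (a * b) v = v
    rw [map_mul, Module.End.mul_apply, show ρ b v = v from hb, show ρ a v = v from ha]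
  inv_mem' := fun {a} ha => by
    change ρ a⁻¹ v = v
    nth_rw 1 [← show ρ a v = v from ha]
    rw [← Module.End.mul_apply, ← map_mul, inv_mul_cancel, map_one, Module.End.one_apply]

theorem mem_vectorStabilizer {k G V : Type*} [CommRing k] [Group G] [AddCommGroup V] [Module k V]
    {ρ : Representation k G V} {v : V} {g : G} : g ∈ ρ.vectorStabilizer v ↔ ρ g v = v := Iff.rfl

/-- In a smooth representation the stabilizers of vectors are open. -/
theorem IsSmooth.isOpen_vectorStabilizer {k G V : Type*} [CommRing k] [Group G]
    [TopologicalSpace G] [AddCommGroup V] [Module k V]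
    {ρ : Representation k G V} (h : ρ.IsSmooth) (v : V) :
    IsOpen (ρ.vectorStabilizer v : Set G) := by
  let _ : TopologicalSpace V := ⊥
  have : DiscreteTopology V := ⟨rfl⟩
  have h' : Continuous fun x : G × V => ρ x.1 x.2 := h
  have h2 : Continuous fun g : G => ρ g v := h'.comp (Continuous.prodMk_left v)
  exact (isOpen_discrete {v}).preimage h2

/-- The additivity of `x ↦ ρ x v - v` along a subgroup fixing its values. -/
theorem apply_pow_sub_self {k G V : Type*} [CommRing k] [Group G] [AddCommGroup V] [Module k V]
    {ρ : Representation k G V} {v : V} {g : G} (h : ρ g (ρ g v - v) = ρ g v - v) (n : ℕ) :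
    ρ (g ^ n) v - v = n • (ρ g v - v) := by
  induction n with
  | zero => simp
  | succ n ih =>
    rw [pow_succ', map_mul, Module.End.mul_apply, sub_eq_iff_eq_add.1 ih, map_add, map_nsmul, h,
      add_smul, one_smul]
    abel

/-- For commuting `g` and `h`, `h` fixes `ρ g v - v` if `g` fixes `ρ h v - v`. -/
theorem mem_vectorStabilizer_comm {k G V : Type*} [CommRing k] [Group G] [AddCommGroup V]
    [Module k V] {ρ : Representation k G V} {v : V} {g h : G} (hc : Commute g h)
    (hg : g ∈ ρ.vectorStabilizer (ρ h v - v)) : h ∈ ρ.vectorStabilizer (ρ g v - v) := by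
  rw [mem_vectorStabilizer, map_sub, ← Module.End.mul_apply, ← map_mul] at hg ⊢
  rw [← hc.eq, sub_eq_iff_eq_add.1 hg]
  abel

end Representation

/-! ### Closed procyclic subgroups fixing a vector -/

/-- Powers of an element of a compact subgroup meet every open subgroup. -/
theorem Subgroup.exists_pow_mem_of_isOpen_of_isCompact {G : Type*} [Group G] [TopologicalSpace G]
    [IsTopologicalGroup G] {K S : Subgroup G} (hK : IsCompact (K : Set G))
    (hS : IsOpen (S : Set G)) {x : G} (hx : x ∈ K) : ∃ n : ℕ, 0 < n ∧ x ^ n ∈ S := by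
  have : CompactSpace K := isCompact_iff_compactSpace.1 hK
  have ho : IsOpen ((S.subgroupOf K : Subgroup K) : Set K) := hS.preimage continuous_subtype_val
  have : Finite (K ⧸ S.subgroupOf K) := Subgroup.quotient_finite_of_isOpen _ ho
  have : (S.subgroupOf K).FiniteIndex := Subgroup.finiteIndex_of_finite_quotient
  obtain ⟨n, hn, -, hm⟩ := Subgroup.exists_pow_mem_of_index_ne_zero
    (H := S.subgroupOf K) Subgroup.FiniteIndex.index_ne_zero ⟨x, hx⟩
  exact ⟨n, hn, hm⟩

/-- If all vectors `ρ g v - v`, `g ∈ K`, have open stabilizers and the characteristic is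
positive, then every `x ∈ K` has a power that topologically generates a group fixing `v`. -/
theorem Representation.exists_closure_zpowers_le_vectorStabilizer
    {k G V : Type*} [CommRing k] [Group G] [TopologicalSpace G] [IsTopologicalGroup G] [T2Space G]
    [AddCommGroup V] [Module k V] {m : ℕ} [CharP k m] (hm : 0 < m)
    {ρ : Representation k G V} {v : V} {K : Subgroup G} (hK : IsCompact (K : Set G))
    (hs : ∀ g ∈ K, IsOpen (ρ.vectorStabilizer (ρ g v - v) : Set G)) {x : G} (hx : x ∈ K) :
    ∃ N : ℕ, 0 < N ∧ (Subgroup.zpowers (x ^ N)).topologicalClosure ≤ ρ.vectorStabilizer v := by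
  have hchar : ∀ w : V, m • w = 0 := fun w => by
    rw [← Nat.cast_smul_eq_nsmul k, CharP.cast_eq_zero, zero_smul]
  obtain ⟨n, hn, hxn⟩ := Subgroup.exists_pow_mem_of_isOpen_of_isCompact hK (hs x hx) hx
  -- `x ^ n` fixes `xv - v`; by commutation `x`, and so also `x ^ n`, fixes `x ^ n v - v`.
  have hy := Subgroup.pow_mem _ (mem_vectorStabilizer_comm (Commute.pow_self x n) hxn) n
  set z := (x ^ n) ^ m with hz
  have hzK : z ∈ K := K.pow_mem (K.pow_mem hx n) _
  have hzv : ρ z v - v = 0 := by rw [hz, apply_pow_sub_self hy, hchar]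
  set C := (Subgroup.zpowers z).topologicalClosure with hC
  have hCK : C ≤ K := Subgroup.topologicalClosure_minimal _ (by simpa using hzK) hK.isClosed
  have hCz : ∀ t ∈ C, Commute t z := by
    intro t ht
    have hle : C ≤ Subgroup.centralizer {z} := by
      refine Subgroup.topologicalClosure_minimal _ ?_ ?_
      · rw [Subgroup.zpowers_le, Subgroup.mem_centralizer_singleton_iff]
      · have : ((Subgroup.centralizer {z} : Subgroup G) : Set G) = {g | z * g = g * z} := by
          ext g
          rw [SetLike.mem_coe, Subgroup.mem_centralizer_singleton_iff]
          exact eq_comm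
        rw [this]
        exact isClosed_eq (by fun_prop) (by fun_prop)
    exact Subgroup.mem_centralizer_singleton_iff.1 (hle ht)
  have hCv : ∀ t ∈ C, t ^ m ∈ ρ.vectorStabilizer v := by
    intro t ht
    -- `t` trivially fixes `zv - v = 0`; commutation turns this into `z` fixing `tv - v`, whose
    -- stabilizer is closed and so contains all of `C`, in particular `t`.
    have h1 : z ∈ ρ.vectorStabilizer (ρ t v - v) :=
      mem_vectorStabilizer_comm (hCz t ht) (by rw [hzv]; exact map_zero _)
    have h2 : C ≤ ρ.vectorStabilizer (ρ t v - v) :=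
      Subgroup.topologicalClosure_minimal _ (by simpa using h1)
        (Subgroup.isClosed_of_isOpen _ (hs t (hCK ht)))
    rw [mem_vectorStabilizer, ← sub_eq_zero, apply_pow_sub_self (h2 ht), hchar]
  -- The first `m` makes `z` fix `v`; the second passes to `m`-th powers of `C`, a compact set of
  -- elements fixing `v` that contains the powers of `z ^ m` and hence their closure.
  refine ⟨n * m * m, by positivity, ?_⟩
  have hCc : IsCompact (C : Set G) := hK.of_isClosed_subset isClosed_closure hCK
  have hDc : IsClosed ((fun t : G => t ^ m) '' (C : Set G)) :=
    (hCc.image (continuous_pow m)).isClosed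
  have hsub : ((Subgroup.zpowers (x ^ (n * m * m)) : Subgroup G) : Set G) ⊆
      (fun t : G => t ^ m) '' (C : Set G) := by
    rintro _ ⟨j, rfl⟩
    refine ⟨z ^ j, Subgroup.le_topologicalClosure _ ⟨j, rfl⟩, ?_⟩
    simp only [hz, ← zpow_natCast, ← zpow_mul]
    congr 1
    push_cast
    ring
  intro g hg
  obtain ⟨t, ht, rfl⟩ := closure_minimal hsub hDc hg
  exact hCv t ht

/-! ### Nearly additive maps and powers -/

/-- A map `ψ` from a subgroup `K` of `G` to a normed group is additive up to `ε` if
`ψ (x * y) - ψ x - ψ y` is Lipschitz with constant `ε` with respect to the pseudometric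
induced by `ψ`. -/
structure NearlyAdditive {G E : Type*} [Group G] [NormedAddCommGroup E] (ψ : G → E)
    (K : Subgroup G) (ε : ℝ) : Prop where
  map_one : ψ 1 = 0
  norm_sub_le : ∀ x ∈ K, ∀ y ∈ K, ∀ x' ∈ K, ∀ y' ∈ K,
    ‖ψ (x * y) - ψ (x' * y') - ((ψ x - ψ x') + (ψ y - ψ y'))‖ ≤
      ε * max ‖ψ x - ψ x'‖ ‖ψ y - ψ y'‖

namespace NearlyAdditive

section

variable {G E : Type*} [Group G] [NormedAddCommGroup E] {ψ : G → E} {K : Subgroup G} {ε : ℝ}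

/-- Only the second factor moves, from `1` to `y`, so the error is relative to `ψ y` alone, however
large `ψ x` is. -/
theorem norm_mul_sub_le_right (h : NearlyAdditive ψ K ε) {x y : G} (hx : x ∈ K) (hy : y ∈ K) :
    ‖ψ (x * y) - (ψ x + ψ y)‖ ≤ ε * ‖ψ y‖ := by
  have := h.norm_sub_le x hx y hy x hx 1 K.one_mem
  simpa [h.map_one, sub_sub] using this

/-- A product of `n` factors is additive up to `ε` in all its factors. -/
theorem norm_prod_sub_le [IsUltrametricDist E] (h : NearlyAdditive ψ K ε) (h0 : 0 ≤ ε)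
    (h1 : ε ≤ 1) {n : ℕ} {c c' : Fin n → G} (hc : ∀ i, c i ∈ K) (hc' : ∀ i, c' i ∈ K) {M : ℝ}
    (hM : 0 ≤ M) (hcc : ∀ i, ‖ψ (c i) - ψ (c' i)‖ ≤ M) :
    ‖ψ (List.ofFn c).prod - ψ (List.ofFn c').prod - ∑ i, (ψ (c i) - ψ (c' i))‖ ≤ ε * M := by
  induction n with
  | zero => simpa using mul_nonneg h0 hM
  | succ n ih =>
    have ih' := ih (fun i => hc i.succ) (fun i => hc' i.succ) (fun i => hcc i.succ)
    rw [List.ofFn_succ, List.ofFn_succ, List.prod_cons, List.prod_cons, Fin.sum_univ_succ]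
    set P := (List.ofFn fun i : Fin n => c i.succ).prod with hP
    set P' := (List.ofFn fun i : Fin n => c' i.succ).prod with hP'
    have hPK : P ∈ K := K.list_prod_mem (by simpa [List.mem_ofFn] using fun i => hc _)
    have hPK' : P' ∈ K := K.list_prod_mem (by simpa [List.mem_ofFn] using fun i => hc' _)
    set S := ∑ i : Fin n, (ψ (c i.succ) - ψ (c' i.succ)) with hS
    have hSM : ‖S‖ ≤ M :=
      IsUltrametricDist.norm_sum_le_of_forall_le_of_nonneg hM fun i _ => hcc i.succ
    have hPM : ‖ψ P - ψ P'‖ ≤ M := by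
      have h2 := IsUltrametricDist.norm_add_le_max (ψ P - ψ P' - S) S
      rw [sub_add_cancel] at h2
      exact h2.trans (max_le (ih'.trans (mul_le_of_le_one_left hM h1)) hSM)
    have h3 := h.norm_sub_le _ (hc 0) _ hPK _ (hc' 0) _ hPK'
    have h4 : ψ (c 0 * P) - ψ (c' 0 * P') - (ψ (c 0) - ψ (c' 0) + S) =
        (ψ (c 0 * P) - ψ (c' 0 * P') - (ψ (c 0) - ψ (c' 0) + (ψ P - ψ P'))) +
          (ψ P - ψ P' - S) := by abel
    rw [h4]
    refine (IsUltrametricDist.norm_add_le_max _ _).trans (max_le (h3.trans ?_) ih')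
    exact mul_le_mul_of_nonneg_left (max_le (hcc 0) hPM) h0

/-- Compare the products of `n` copies of `x` and of `n` copies of `1`. -/
theorem norm_pow_sub_le [IsUltrametricDist E] (h : NearlyAdditive ψ K ε) (h0 : 0 ≤ ε)
    (h1 : ε ≤ 1) {x : G} (hx : x ∈ K) (n : ℕ) : ‖ψ (x ^ n) - n • ψ x‖ ≤ ε * ‖ψ x‖ := by
  have := h.norm_prod_sub_le h0 h1 (n := n) (c := fun _ => x) (c' := fun _ => 1)
    (fun _ => hx) (fun _ => K.one_mem) (norm_nonneg (ψ x)) (by simp [h.map_one])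
  simpa [h.map_one] using this

end

section Padic

variable {p : ℕ} [Fact p.Prime] {G E : Type*} [Group G] [NormedAddCommGroup E] [NormedSpace ℚ_[p] E]
  [IsUltrametricDist E] {ψ : G → E} {K : Subgroup G}

/-- Taking powers is linear in the exponent up to a factor `p⁻¹`. -/
theorem norm_pow_sub_smul_le (h : NearlyAdditive ψ K ((p : ℝ)⁻¹ ^ 2)) (n : ℕ) {x : G}
    (hx : x ∈ K) :
    ‖ψ (x ^ n) - (n : ℚ_[p]) • ψ x‖ ≤ (p : ℝ)⁻¹ * (‖(n : ℚ_[p])‖ * ‖ψ x‖) := by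
  have hp : (1 : ℝ) < p := by exact_mod_cast (Fact.out : p.Prime).one_lt
  have hq0 : (0 : ℝ) < (p : ℝ)⁻¹ := by positivity
  have hq1 : (p : ℝ)⁻¹ ≤ 1 := inv_le_one_of_one_le₀ hp.le
  have hε1 : (p : ℝ)⁻¹ ^ 2 ≤ 1 := pow_le_one₀ hq0.le hq1
  have hbase : ∀ (n : ℕ) {x : G}, x ∈ K →
      ‖ψ (x ^ n) - (n : ℚ_[p]) • ψ x‖ ≤ (p : ℝ)⁻¹ ^ 2 * ‖ψ x‖ := fun n x hx => by
    rw [Nat.cast_smul_eq_nsmul]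
    exact h.norm_pow_sub_le (by positivity) hε1 hx n
  -- `hbase` suffices when `‖n‖ = 1`. Otherwise write `x ^ (p * l) = (x ^ p) ^ l`, where `ψ (x ^ p)`
  -- is smaller than `ψ x` by `p⁻¹`. Of the two factors `p⁻¹` in the hypothesis, one is absorbed
  -- into `‖p‖`.
  induction n using Nat.strong_induction_on generalizing x with
  | _ n ih =>
    rcases Nat.eq_zero_or_pos n with rfl | hn
    · simp [h.map_one]
    by_cases hpn : p ∣ n
    · obtain ⟨l, rfl⟩ := hpn
      have hl : l < p * l := lt_mul_of_one_lt_left (Nat.pos_of_mul_pos_left hn)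
        (Fact.out : p.Prime).one_lt
      have h2 := hbase p hx
      have h3 : ‖ψ (x ^ p)‖ ≤ (p : ℝ)⁻¹ * ‖ψ x‖ := by
        rw [← sub_add_cancel (ψ (x ^ p)) ((p : ℚ_[p]) • ψ x)]
        refine (IsUltrametricDist.norm_add_le_max _ _).trans (max_le (h2.trans ?_) ?_)
        · rw [pow_two, mul_assoc]
          exact mul_le_of_le_one_left (by positivity) hq1
        · rw [norm_smul, Padic.norm_p]
      have h4 := ih l hl (K.pow_mem hx p)
      rw [← pow_mul] at h4
      have h5 : ψ (x ^ (p * l)) - ((p * l : ℕ) : ℚ_[p]) • ψ x =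
          (ψ (x ^ (p * l)) - (l : ℚ_[p]) • ψ (x ^ p)) +
            (l : ℚ_[p]) • (ψ (x ^ p) - (p : ℚ_[p]) • ψ x) := by
        rw [smul_sub, smul_smul]
        push_cast
        rw [mul_comm (p : ℚ_[p])]
        abel
      rw [h5]
      refine (IsUltrametricDist.norm_add_le_max _ _).trans (max_le (h4.trans ?_) ?_)
      · push_cast
        rw [norm_mul, Padic.norm_p]
        calc (p : ℝ)⁻¹ * (‖(l : ℚ_[p])‖ * ‖ψ (x ^ p)‖)
            ≤ (p : ℝ)⁻¹ * (‖(l : ℚ_[p])‖ * ((p : ℝ)⁻¹ * ‖ψ x‖)) := by gcongr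
          _ = _ := by ring
      · push_cast
        rw [norm_smul, norm_mul, Padic.norm_p]
        calc ‖(l : ℚ_[p])‖ * ‖ψ (x ^ p) - (p : ℚ_[p]) • ψ x‖
            ≤ ‖(l : ℚ_[p])‖ * ((p : ℝ)⁻¹ ^ 2 * ‖ψ x‖) := by gcongr
          _ = _ := by ring
    · have hn1 : ‖(n : ℚ_[p])‖ = 1 := by
        rw [Padic.norm_natCast_eq_one_iff]
        exact (Nat.Prime.coprime_iff_not_dvd Fact.out).2 hpn
      rw [hn1, one_mul]
      refine (hbase n hx).trans ?_
      rw [pow_two, mul_assoc]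
      exact mul_le_of_le_one_left (by positivity) hq1

/-- Powers of `x` approximate the multiples of `ψ x` by `p`-adic integers. -/
theorem exists_pow_norm_sub_smul_le (h : NearlyAdditive ψ K ((p : ℝ)⁻¹ ^ 2)) {x : G} (hx : x ∈ K)
    {a : ℚ_[p]} (ha : ‖a‖ ≤ 1) :
    ∃ n : ℕ, ‖ψ (x ^ n) - a • ψ x‖ ≤ (p : ℝ)⁻¹ * (‖a‖ * ‖ψ x‖) := by
  rcases eq_or_ne a 0 with rfl | ha0
  · exact ⟨0, by simp [h.map_one]⟩
  have hp : (1 : ℝ) < p := by exact_mod_cast (Fact.out : p.Prime).one_lt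
  have hq1 : (p : ℝ)⁻¹ < 1 := inv_lt_one_of_one_lt₀ hp
  have hapos : 0 < ‖a‖ := norm_pos_iff.2 ha0
  -- The precision is relative to `‖a‖`, which also forces `‖n‖ ≤ ‖a‖`.
  obtain ⟨n, hn⟩ := PadicInt.denseRange_natCast.exists_dist_lt (⟨a, ha⟩ : ℤ_[p])
    (show 0 < (p : ℝ)⁻¹ * ‖a‖ by positivity)
  have hn' : ‖(n : ℚ_[p]) - a‖ ≤ (p : ℝ)⁻¹ * ‖a‖ := by
    rw [norm_sub_rev]
    exact hn.le
  have hna : ‖(n : ℚ_[p])‖ ≤ ‖a‖ := by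
    rw [← sub_add_cancel (n : ℚ_[p]) a]
    refine (IsUltrametricDist.norm_add_le_max _ _).trans (max_le (hn'.trans ?_) le_rfl)
    exact mul_le_of_le_one_left hapos.le hq1.le
  refine ⟨n, ?_⟩
  rw [← sub_add_sub_cancel _ ((n : ℚ_[p]) • ψ x), ← sub_smul]
  refine (IsUltrametricDist.norm_add_le_max _ _).trans
    (max_le ((h.norm_pow_sub_smul_le n hx).trans ?_) ?_)
  · gcongr
  · rw [norm_smul, ← mul_assoc]
    gcongr

end Padic

end NearlyAdditive

/-! ### Charts of `p`-adic analytic groups -/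

/-- In a chart around `1`, the multiplication of a `p`-adic analytic group is strictly
differentiable at the origin, with derivative the addition. -/
theorem LieGroup.hasStrictFDerivAt_mul_chart {p : ℕ} [Fact p.Prime] {d : ℕ}
    {G : Type*} [Group G] [TopologicalSpace G]
    [ChartedSpace (Fin d → ℚ_[p]) G] [LieGroup 𝓘(ℚ_[p], Fin d → ℚ_[p]) ω G] :
    HasStrictFDerivAt (𝕜 := ℚ_[p]) (fun z : (Fin d → ℚ_[p]) × (Fin d → ℚ_[p]) =>
        chartAt (Fin d → ℚ_[p]) (1 : G) ((chartAt (Fin d → ℚ_[p]) (1 : G)).symm z.1 *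
          (chartAt (Fin d → ℚ_[p]) (1 : G)).symm z.2))
      (ContinuousLinearMap.fst ℚ_[p] (Fin d → ℚ_[p]) (Fin d → ℚ_[p]) +
        ContinuousLinearMap.snd ℚ_[p] (Fin d → ℚ_[p]) (Fin d → ℚ_[p]))
      (chartAt (Fin d → ℚ_[p]) (1 : G) 1, chartAt (Fin d → ℚ_[p]) (1 : G) 1) := by
  set e := chartAt (Fin d → ℚ_[p]) (1 : G) with he
  set a := e 1 with ha
  have h1 : (1 : G) ∈ e.source := mem_chart_source _ _
  have hat : a ∈ e.target := e.map_source h1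
  have ha1 : e.symm a = 1 := e.left_inv h1
  have hsymm : ContMDiffAt 𝓘(ℚ_[p], Fin d → ℚ_[p]) 𝓘(ℚ_[p], Fin d → ℚ_[p]) ω e.symm a :=
    (contMDiffOn_chart_symm (I := 𝓘(ℚ_[p], Fin d → ℚ_[p])) (n := ω) (x := (1 : G))).contMDiffAt
      (e.open_target.mem_nhds hat)
  have hchart : ContMDiffAt 𝓘(ℚ_[p], Fin d → ℚ_[p]) 𝓘(ℚ_[p], Fin d → ℚ_[p]) ω e (1 : G) :=
    (contMDiffOn_chart (I := 𝓘(ℚ_[p], Fin d → ℚ_[p])) (n := ω) (x := (1 : G))).contMDiffAt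
      (e.open_source.mem_nhds h1)
  have hfst : ContMDiffAt 𝓘(ℚ_[p], (Fin d → ℚ_[p]) × (Fin d → ℚ_[p])) 𝓘(ℚ_[p], Fin d → ℚ_[p]) ω
      (fun z : (Fin d → ℚ_[p]) × (Fin d → ℚ_[p]) => e.symm z.1) (a, a) :=
    ContMDiffAt.comp (a, a) (g := e.symm) (f := Prod.fst) hsymm
      (contDiff_fst.contMDiff.contMDiffAt)
  have hsnd : ContMDiffAt 𝓘(ℚ_[p], (Fin d → ℚ_[p]) × (Fin d → ℚ_[p])) 𝓘(ℚ_[p], Fin d → ℚ_[p]) ω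
      (fun z : (Fin d → ℚ_[p]) × (Fin d → ℚ_[p]) => e.symm z.2) (a, a) :=
    ContMDiffAt.comp (a, a) (g := e.symm) (f := Prod.snd) hsymm
      (contDiff_snd.contMDiff.contMDiffAt)
  have hmul := hfst.mul hsnd
  have hF := (ContMDiffAt.comp_of_eq (g := e) (f := fun z : (Fin d → ℚ_[p]) × (Fin d → ℚ_[p]) =>
    e.symm z.1 * e.symm z.2) hchart hmul (by simp [ha1])).contDiffAt.analyticAt.hasStrictFDerivAt
  set L := fderiv ℚ_[p] (e ∘ fun z : (Fin d → ℚ_[p]) × (Fin d → ℚ_[p]) =>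
    e.symm z.1 * e.symm z.2) (a, a) with hL
  have hev : ∀ᶠ x in nhds a, e (e.symm x) = x :=
    Filter.eventually_of_mem (e.open_target.mem_nhds hat) fun x hx => e.right_inv hx
  have hl : L.comp (ContinuousLinearMap.inl ℚ_[p] _ _) = ContinuousLinearMap.id ℚ_[p] _ := by
    refine HasFDerivAt.unique 
      (HasFDerivAt.comp (f := fun x => (x, a)) a hF.hasFDerivAt (hasFDerivAt_prodMk_left a a)) ?_
    refine (hasFDerivAt_id a).congr_of_eventuallyEq (hev.mono fun x hx => ?_)
    simp [ha1, hx]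
  have hr : L.comp (ContinuousLinearMap.inr ℚ_[p] _ _) = ContinuousLinearMap.id ℚ_[p] _ := by
    refine HasFDerivAt.unique 
      (HasFDerivAt.comp (f := fun x => (a, x)) a hF.hasFDerivAt (hasFDerivAt_prodMk_right a a)) ?_
    refine (hasFDerivAt_id a).congr_of_eventuallyEq (hev.mono fun x hx => ?_)
    simp [ha1, hx]
  have hLeq : L = ContinuousLinearMap.fst ℚ_[p] _ _ + ContinuousLinearMap.snd ℚ_[p] _ _ := by
    refine ContinuousLinearMap.ext fun z => ?_
    have h2 := DFunLike.congr_fun hl z.1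
    have h3 := DFunLike.congr_fun hr z.2
    simp only [ContinuousLinearMap.comp_apply, ContinuousLinearMap.inl_apply,
      ContinuousLinearMap.inr_apply, ContinuousLinearMap.id_apply] at h2 h3
    calc L z = L ((z.1, 0) + (0, z.2)) := by simp
      _ = _ := by rw [map_add, h2, h3]; rfl
  rw [← hLeq]
  exact hF

/-- A `p`-adic analytic group has arbitrarily small compact open subgroups on which a chart is
nearly additive. -/
theorem LieGroup.exists_nearlyAdditive {p : ℕ} [Fact p.Prime] {d : ℕ}
    {G : Type*} [Group G] [TopologicalSpace G] [IsTopologicalGroup G]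
    [ChartedSpace (Fin d → ℚ_[p]) G] [LieGroup 𝓘(ℚ_[p], Fin d → ℚ_[p]) ω G]
    {ε : ℝ} (hε : 0 < ε) (hε1 : ε ≤ 1) {U : Set G} (hU : U ∈ nhds (1 : G)) :
    ∃ (ψ : G → Fin d → ℚ_[p]) (K : Subgroup G) (r : ℝ), 0 < r ∧ IsOpen (K : Set G) ∧
      IsCompact (K : Set G) ∧ (K : Set G) ⊆ U ∧ NearlyAdditive ψ K ε ∧
      ContinuousOn ψ (K : Set G) ∧ Set.InjOn ψ (K : Set G) ∧
      ψ '' (K : Set G) = Metric.closedBall 0 r := by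
  set e := chartAt (Fin d → ℚ_[p]) (1 : G) with he
  set a := e 1 with ha
  have h1 : (1 : G) ∈ e.source := mem_chart_source _ _
  have hat : a ∈ e.target := e.map_source h1
  have ha1 : e.symm a = 1 := e.left_inv h1
  obtain ⟨s, hs, hsa⟩ := (LieGroup.hasStrictFDerivAt_mul_chart (p := p) (d := d)
    (G := G)).approximates_deriv_on_nhds (c := NNReal.mk ε hε.le) (Or.inr hε)
  have hsymm : ContinuousAt e.symm a := e.continuousAt_symm hat
  have hcmul : ContinuousAt (fun z : (Fin d → ℚ_[p]) × (Fin d → ℚ_[p]) => e.symm z.1 * e.symm z.2)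
      (a, a) :=
    (ContinuousAt.comp (x := (a, a)) hsymm continuousAt_fst).mul
      (ContinuousAt.comp (x := (a, a)) hsymm continuousAt_snd)
  have hsrc : ∀ᶠ z in nhds (a, a), e.symm z.1 * e.symm z.2 ∈ e.source :=
    hcmul.eventually (e.open_source.mem_nhds (by simpa [ha1] using h1))
  obtain ⟨r₀, hr₀, hball₀⟩ := Metric.nhds_basis_closedBall.mem_iff.1 (Filter.inter_mem hs hsrc)
  have hinv : ∀ᶠ x in nhds a, (e.symm x)⁻¹ ∈ e.source ∧ e (e.symm x)⁻¹ ∈ Metric.closedBall a r₀ := by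
    have hc : ContinuousAt (fun x => (e.symm x)⁻¹) a := hsymm.inv
    have hc' : ContinuousAt (fun x => e (e.symm x)⁻¹) a :=
      ContinuousAt.comp_of_eq (g := e) (f := fun x => (e.symm x)⁻¹) (e.continuousAt h1) hc
        (by simp [ha1])
    refine (hc.eventually (e.open_source.mem_nhds (by simpa [ha1] using h1))).and
      (hc'.eventually (by
        change ∀ᶠ y in nhds (e (e.symm a)⁻¹), y ∈ Metric.closedBall a r₀
        rw [ha1, inv_one]
        exact Metric.closedBall_mem_nhds a hr₀))
  have hUe : ∀ᶠ x in nhds a, e.symm x ∈ U := hsymm.eventually (by rwa [ha1])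
  obtain ⟨r₁, hr₁, hball₁⟩ := Metric.nhds_basis_closedBall.mem_iff.1
    (Filter.inter_mem (Filter.inter_mem hinv hUe) (e.open_target.mem_nhds hat))
  -- On the `r₀`-ball the estimate for products holds; elements of the `r₁`-ball lie in `U` and have
  -- inverses in the `r₀`-ball.
  set r := min r₀ r₁ with hr
  have hrpos : 0 < r := lt_min hr₀ hr₁
  set ψ : G → Fin d → ℚ_[p] := fun g => e g - a with hψ
  have hψ1 : ψ 1 = 0 := sub_self _
  have hmem₀ : ∀ {g h : G}, ‖ψ g‖ ≤ r₀ → ‖ψ h‖ ≤ r₀ →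
      (e g, e h) ∈ Metric.closedBall ((a, a) : (Fin d → ℚ_[p]) × (Fin d → ℚ_[p])) r₀ := by
    intro g h hg hh
    rw [Metric.mem_closedBall, Prod.dist_eq, dist_eq_norm, dist_eq_norm]
    exact max_le hg hh
  have hest : ∀ x ∈ e.source, ‖ψ x‖ ≤ r₀ → ∀ y ∈ e.source, ‖ψ y‖ ≤ r₀ →
      ∀ x' ∈ e.source, ‖ψ x'‖ ≤ r₀ → ∀ y' ∈ e.source, ‖ψ y'‖ ≤ r₀ →
      ‖ψ (x * y) - ψ (x' * y') - ((ψ x - ψ x') + (ψ y - ψ y'))‖ ≤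
        ε * max ‖ψ x - ψ x'‖ ‖ψ y - ψ y'‖ := by
    intro x hx hxr y hy hyr x' hx' hxr' y' hy' hyr'
    have h2 := hsa _ (hball₀ (hmem₀ hxr hyr)).1 _ (hball₀ (hmem₀ hxr' hyr')).1
    rw [NNReal.coe_mk] at h2
    simpa [← he, e.left_inv, hx, hy, hx', hy', hψ, Prod.norm_def] using h2
  have hsource : ∀ x ∈ e.source, ‖ψ x‖ ≤ r₀ → ∀ y ∈ e.source, ‖ψ y‖ ≤ r₀ → x * y ∈ e.source := by
    intro x hx hxr y hy hyr
    simpa [e.left_inv, hx, hy] using (hball₀ (hmem₀ hxr hyr)).2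
  have hest' : ∀ x ∈ e.source, ‖ψ x‖ ≤ r₀ → ∀ y ∈ e.source, ‖ψ y‖ ≤ r₀ →
      ‖ψ (x * y) - (ψ x + ψ y)‖ ≤ ‖ψ x‖ := by
    intro x hx hxr y hy hyr
    -- Only the first factor moves. With the ultrametric inequality this gives closure of the ball
    -- under products and, for `y = x⁻¹`, under inverses.
    have h2 := hest x hx hxr y hy hyr 1 h1 (by simpa [hψ1] using hr₀.le) y hy hyr
    simp only [hψ1, one_mul, sub_zero, sub_self, add_zero, norm_zero, norm_nonneg,
      sup_of_le_left] at h2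
    rw [show ψ (x * y) - (ψ x + ψ y) = ψ (x * y) - ψ y - ψ x by abel]
    exact h2.trans (mul_le_of_le_one_left (norm_nonneg _) hε1)
  let K : Subgroup G :=
    { carrier := {g | g ∈ e.source ∧ ‖ψ g‖ ≤ r}
      one_mem' := ⟨h1, by rw [hψ1, norm_zero]; exact hrpos.le⟩
      mul_mem' := by
        rintro x y ⟨hx, hxr⟩ ⟨hy, hyr⟩
        have hx0 := hxr.trans (min_le_left _ _)
        have hy0 := hyr.trans (min_le_left _ _)
        refine ⟨hsource x hx hx0 y hy hy0, ?_⟩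
        rw [← sub_add_cancel (ψ (x * y)) (ψ x + ψ y)]
        exact (IsUltrametricDist.norm_add_le_max _ _).trans (max_le
          ((hest' x hx hx0 y hy hy0).trans hxr)
          ((IsUltrametricDist.norm_add_le_max _ _).trans (max_le hxr hyr)))
      inv_mem' := by
        rintro x ⟨hx, hxr⟩
        have hx0 := hxr.trans (min_le_left _ _)
        have h2 : e x ∈ Metric.closedBall a r₁ := by
          rw [Metric.mem_closedBall, dist_eq_norm]
          exact hxr.trans (min_le_right _ _)
        have h3 := (hball₁ h2).1.1
        simp only [Set.mem_ofPred_eq, e.left_inv hx, Metric.mem_closedBall, dist_eq_norm] at h3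
        refine ⟨h3.1, ?_⟩
        have h4 := hest' x hx hx0 x⁻¹ h3.1 h3.2
        rw [mul_inv_cancel, hψ1, zero_sub, norm_neg] at h4
        rw [show ψ x⁻¹ = (ψ x + ψ x⁻¹) + -ψ x by abel]
        exact (IsUltrametricDist.norm_add_le_max _ _).trans
          (max_le (h4.trans hxr) (by rwa [norm_neg])) }
  have hK : ∀ g, g ∈ K ↔ g ∈ e.source ∧ ‖ψ g‖ ≤ r := fun g => Iff.rfl
  have hKball : (K : Set G) = e.symm '' Metric.closedBall a r := by
    ext g
    rw [SetLike.mem_coe, hK]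
    constructor
    · rintro ⟨hg, hgr⟩
      exact ⟨e g, by rwa [Metric.mem_closedBall, dist_eq_norm], e.left_inv hg⟩
    · rintro ⟨x, hx, rfl⟩
      have hxt := (hball₁ (Metric.closedBall_subset_closedBall (min_le_right _ _) hx)).2
      refine ⟨e.map_target hxt, ?_⟩
      rw [hψ]
      simpa [e.right_inv hxt, dist_eq_norm] using hx
  have hrt : Metric.closedBall a r ⊆ e.target := fun x hx =>
    (hball₁ (Metric.closedBall_subset_closedBall (min_le_right _ _) hx)).2
  refine ⟨ψ, K, r, hrpos, ?_, ?_, ?_, ⟨hψ1, ?_⟩, ?_, ?_, ?_⟩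
  · rw [hKball]
    exact e.isOpen_image_symm_of_subset_target
      (IsUltrametricDist.isOpen_closedBall _ hrpos.ne') hrt
  · rw [hKball]
    exact (isCompact_closedBall _ _).image_of_continuousOn (e.continuousOn_symm.mono hrt)
  · rw [hKball]
    rintro _ ⟨x, hx, rfl⟩
    exact (hball₁ (Metric.closedBall_subset_closedBall (min_le_right _ _) hx)).1.2
  · intro x hx y hy x' hx' y' hy'
    exact hest x hx.1 (hx.2.trans (min_le_left _ _)) y hy.1 (hy.2.trans (min_le_left _ _))
      x' hx'.1 (hx'.2.trans (min_le_left _ _)) y' hy'.1 (hy'.2.trans (min_le_left _ _))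
  · exact (e.continuousOn.mono fun g hg => hg.1).sub continuousOn_const
  · intro x hx y hy hxy
    exact e.injOn hx.1 hy.1 (sub_left_injective hxy)
  · ext y
    rw [mem_closedBall_zero_iff]
    constructor
    · rintro ⟨g, hg, rfl⟩
      exact hg.2
    · intro hy
      have hya : y + a ∈ Metric.closedBall a r := by simpa [dist_eq_norm] using hy
      refine ⟨e.symm (y + a), ?_, ?_⟩
      · rw [hKball]
        exact ⟨_, hya, rfl⟩
      · rw [hψ]
        simp [e.right_inv (hrt hya)]

/-! ### Products of procyclic subgroups -/

/-- Let `ψ` identify a compact group `K` with a ball of `ℚ_p ^ d` and be nearly additive. If a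
subgroup `Z` contains, for each `x ∈ K`, the closed subgroup generated by some power of `x`,
then `Z` contains a neighbourhood of `1`. -/
theorem NearlyAdditive.exists_forall_norm_le_mem {p : ℕ} [Fact p.Prime] {d : ℕ}
    {G : Type*} [Group G] [TopologicalSpace G] [IsTopologicalGroup G] [T2Space G]
    {ψ : G → Fin d → ℚ_[p]} {K Z : Subgroup G} {r : ℝ} (hr : 0 < r)
    (h : NearlyAdditive ψ K ((p : ℝ)⁻¹ ^ 2)) (hK : IsCompact (K : Set G))
    (hcont : ContinuousOn ψ (K : Set G)) (hinj : Set.InjOn ψ (K : Set G))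
    (him : ψ '' (K : Set G) = Metric.closedBall 0 r)
    (hZ : ∀ x ∈ K, ∃ N : ℕ, 0 < N ∧ (Subgroup.zpowers (x ^ N)).topologicalClosure ≤ Z) :
    ∃ R : ℝ, 0 < R ∧ ∀ g ∈ K, ‖ψ g‖ ≤ R → g ∈ Z := by
  have hp : (1 : ℝ) < p := by exact_mod_cast (Fact.out : p.Prime).one_lt
  have hq0 : (0 : ℝ) < (p : ℝ)⁻¹ := by positivity
  have hq1 : (p : ℝ)⁻¹ < 1 := inv_lt_one_of_one_lt₀ hp
  have hε1 : (p : ℝ)⁻¹ ^ 2 ≤ 1 := pow_le_one₀ hq0.le hq1.le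
  have hεq : (p : ℝ)⁻¹ ^ 2 ≤ (p : ℝ)⁻¹ := by
    rw [pow_two]
    exact mul_le_of_le_one_left hq0.le hq1.le
  obtain ⟨π, hπ0, hπr⟩ := NormedField.exists_norm_lt ℚ_[p] hr
  have hx : ∀ i : Fin d, ∃ x ∈ K, ψ x = Pi.single i π := fun i => by
    have h2 : (Pi.single i π : Fin d → ℚ_[p]) ∈ Metric.closedBall (0 : Fin d → ℚ_[p]) r := by
      rw [mem_closedBall_zero_iff, Pi.norm_single]
      exact hπr.le
    rwa [← him] at h2
  choose x hxK hxψ using hx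
  choose n hn0 hnZ using fun i => hZ (x i) (hxK i)
  -- A common exponent for all `d` directions.
  set N := ∏ i, n i with hN
  have hN0 : N ≠ 0 := Finset.prod_ne_zero_iff.2 fun i _ => (hn0 i).ne'
  set C : Fin d → Subgroup G := fun i => (Subgroup.zpowers (x i ^ N)).topologicalClosure with hC
  have hCZ : ∀ i, C i ≤ Z := fun i => by
    refine le_trans ?_ (hnZ i)
    refine Subgroup.topologicalClosure_mono ?_
    rw [Subgroup.zpowers_le]
    obtain ⟨l, hl⟩ := Finset.dvd_prod_of_mem n (Finset.mem_univ i)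
    rw [hN, hl, pow_mul]
    exact Subgroup.pow_mem _ (Subgroup.mem_zpowers _) _
  have hCK : ∀ i, C i ≤ K := fun i =>
    Subgroup.topologicalClosure_minimal _ (by simpa using K.pow_mem (hxK i) N) hK.isClosed
  have hNQ : (N : ℚ_[p]) ≠ 0 := by exact_mod_cast hN0
  set R := ‖(N : ℚ_[p])‖ * ‖π‖ with hR
  have hR0 : 0 < R := mul_pos (norm_pos_iff.2 hNQ) hπ0
  -- `C i` covers the `i`-th axis up to relative error `p⁻¹`: since `ψ (x i ^ N)` is close to `N *
  -- π` times the basis vector, a power approximating `α = δ / (N * π)` works.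
  have happrox : ∀ (i : Fin d) (δ : ℚ_[p]), ‖δ‖ ≤ R →
      ∃ v ∈ C i, ‖ψ v - Pi.single i δ‖ ≤ (p : ℝ)⁻¹ * ‖δ‖ := by
    intro i δ hδ
    set α := δ / (N * π) with hα
    have hδα : δ = α * (N * π) := by
      rw [hα, div_mul_cancel₀]
      exact mul_ne_zero hNQ (norm_pos_iff.1 hπ0)
    have hδn : ‖δ‖ = ‖α‖ * R := by rw [hδα, norm_mul, norm_mul]
    have hα1 : ‖α‖ ≤ 1 := by
      rw [hα, norm_div, norm_mul]
      exact div_le_one_of_le₀ hδ hR0.le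
    have h2 := h.norm_pow_sub_smul_le N (hxK i)
    have hsingle : ‖ψ (x i)‖ = ‖π‖ := by rw [hxψ, Pi.norm_single]
    rw [hsingle] at h2
    have h3 : ‖ψ (x i ^ N)‖ ≤ R := by
      rw [← sub_add_cancel (ψ (x i ^ N)) ((N : ℚ_[p]) • ψ (x i))]
      refine (IsUltrametricDist.norm_add_le_max _ _).trans (max_le (h2.trans ?_) ?_)
      · exact mul_le_of_le_one_left hR0.le hq1.le
      · rw [norm_smul, hsingle]
    obtain ⟨l, hl⟩ := h.exists_pow_norm_sub_smul_le (K.pow_mem (hxK i) N) hα1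
    refine ⟨(x i ^ N) ^ l, Subgroup.pow_mem _
      (Subgroup.le_topologicalClosure _ (Subgroup.mem_zpowers _)) _, ?_⟩
    have h4 : ψ ((x i ^ N) ^ l) - Pi.single i δ = (ψ ((x i ^ N) ^ l) - α • ψ (x i ^ N)) +
        α • (ψ (x i ^ N) - (N : ℚ_[p]) • ψ (x i)) := by
      rw [smul_sub, hxψ, ← Pi.single_smul, ← Pi.single_smul, smul_eq_mul, smul_eq_mul, ← hδα]
      abel
    rw [h4, hδn]
    refine (IsUltrametricDist.norm_add_le_max _ _).trans (max_le (hl.trans ?_) ?_)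
    · gcongr
    · rw [norm_smul]
      calc ‖α‖ * ‖ψ (x i ^ N) - (N : ℚ_[p]) • ψ (x i)‖ ≤ ‖α‖ * ((p : ℝ)⁻¹ * R) := by gcongr
        _ = _ := by ring
  refine ⟨R, hR0, fun g hg hgR => ?_⟩
  -- Successive approximation: the coordinates of the remaining error are corrected by multiplying
  -- each `c i` on the right by some `v i ∈ C i`, which keeps the factors in `C i` and gains `p⁻¹`.
  have hseq : ∀ j : ℕ, ∃ c : Fin d → G, (∀ i, c i ∈ C i) ∧
      ‖ψ g - ψ (List.ofFn c).prod‖ ≤ R * (p : ℝ)⁻¹ ^ j := by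
    intro j
    induction j with
    | zero => exact ⟨fun _ => 1, fun i => (C i).one_mem, by simpa [h.map_one] using hgR⟩
    | succ j ih =>
      obtain ⟨c, hc, hcg⟩ := ih
      set δ := ψ g - ψ (List.ofFn c).prod with hδ
      have hδR : ‖δ‖ ≤ R := hcg.trans
        (mul_le_of_le_one_right hR0.le (pow_le_one₀ hq0.le hq1.le))
      have hδi : ∀ i, ‖δ i‖ ≤ ‖δ‖ := norm_le_pi_norm δ
      choose v hvC hv using fun i => happrox i (δ i) ((hδi i).trans hδR)
      have hvδ : ∀ i, ‖ψ (v i) - Pi.single i (δ i)‖ ≤ (p : ℝ)⁻¹ * ‖δ‖ := fun i =>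
        (hv i).trans (by gcongr; exact hδi i)
      have hqδ : (p : ℝ)⁻¹ * ‖δ‖ ≤ ‖δ‖ := mul_le_of_le_one_left (norm_nonneg _) hq1.le
      have hvn : ∀ i, ‖ψ (v i)‖ ≤ ‖δ‖ := fun i => by
        rw [← sub_add_cancel (ψ (v i)) (Pi.single i (δ i))]
        refine (IsUltrametricDist.norm_add_le_max _ _).trans (max_le ((hvδ i).trans hqδ) ?_)
        rw [Pi.norm_single]
        exact hδi i
      have hcv : ∀ i, ‖ψ (c i * v i) - ψ (c i) - Pi.single i (δ i)‖ ≤ (p : ℝ)⁻¹ * ‖δ‖ := by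
        intro i
        rw [show ψ (c i * v i) - ψ (c i) - Pi.single i (δ i) =
          (ψ (c i * v i) - (ψ (c i) + ψ (v i))) + (ψ (v i) - Pi.single i (δ i)) by abel]
        refine (IsUltrametricDist.norm_add_le_max _ _).trans (max_le ?_ (hvδ i))
        refine (h.norm_mul_sub_le_right (hCK i (hc i)) (hCK i (hvC i))).trans ?_
        gcongr
        exact hvn i
      have hcv' : ∀ i, ‖ψ (c i * v i) - ψ (c i)‖ ≤ ‖δ‖ := fun i => by
        rw [← sub_add_cancel (ψ (c i * v i) - ψ (c i)) (Pi.single i (δ i))]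
        refine (IsUltrametricDist.norm_add_le_max _ _).trans (max_le ((hcv i).trans hqδ) ?_)
        rw [Pi.norm_single]
        exact hδi i
      refine ⟨fun i => c i * v i, fun i => (C i).mul_mem (hc i) (hvC i), ?_⟩
      have h5 := h.norm_prod_sub_le (by positivity) hε1
        (fun i => K.mul_mem (hCK i (hc i)) (hCK i (hvC i))) (fun i => hCK i (hc i))
        (norm_nonneg δ) hcv'
      have h6 : ‖∑ i, (ψ (c i * v i) - ψ (c i)) - δ‖ ≤ (p : ℝ)⁻¹ * ‖δ‖ := by
        rw [show ∑ i, (ψ (c i * v i) - ψ (c i)) - δ =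
            ∑ i, (ψ (c i * v i) - ψ (c i) - Pi.single i (δ i)) by
          rw [Finset.sum_sub_distrib _ fun i => Pi.single i (δ i), Finset.univ_sum_single]]
        exact IsUltrametricDist.norm_sum_le_of_forall_le_of_nonneg (by positivity)
          fun i _ => hcv i
      rw [norm_sub_rev, show ψ (List.ofFn fun i => c i * v i).prod - ψ g =
        (ψ (List.ofFn fun i => c i * v i).prod - ψ (List.ofFn c).prod -
          ∑ i, (ψ (c i * v i) - ψ (c i))) + (∑ i, (ψ (c i * v i) - ψ (c i)) - δ) by
            rw [hδ]; abel]
      have h7 : (p : ℝ)⁻¹ * ‖δ‖ ≤ R * (p : ℝ)⁻¹ ^ (j + 1) := by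
        calc (p : ℝ)⁻¹ * ‖δ‖ ≤ (p : ℝ)⁻¹ * (R * (p : ℝ)⁻¹ ^ j) := by gcongr
          _ = _ := by ring
      refine (IsUltrametricDist.norm_add_le_max _ _).trans (max_le (h5.trans ?_) (h6.trans h7))
      exact le_trans (by gcongr) h7
  set P : Set G := (fun c : Fin d → G => (List.ofFn c).prod) '' Set.pi Set.univ fun i => (C i : Set G)
    with hP
  have hPc : IsCompact P := by
    refine IsCompact.image (isCompact_univ_pi fun i => hK.of_isClosed_subset isClosed_closure
      (hCK i)) ?_
    simp only [List.ofFn_eq_map]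
    exact continuous_list_prod _ fun i _ => continuous_apply i
  have hPmem : ∀ {S : Subgroup G}, (∀ i, C i ≤ S) → P ⊆ S := by
    rintro S hS _ ⟨c, hc, rfl⟩
    refine S.list_prod_mem fun y hy => ?_
    obtain ⟨i, rfl⟩ := (List.mem_ofFn' _ _).1 hy
    exact hS i (hc i trivial)
  -- Compactness replaces convergence of the approximations: `ψ g` is in the closure of `ψ '' P`,
  -- and injectivity of `ψ` on `K` then gives `g ∈ P`.
  have hPcl : IsClosed (ψ '' P) := (hPc.image_of_continuousOn (hcont.mono (hPmem hCK))).isClosed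
  have hgP : ψ g ∈ ψ '' P := by
    rw [← hPcl.closure_eq, Metric.mem_closure_iff]
    intro η hη
    obtain ⟨j, hj⟩ := exists_pow_lt_of_lt_one (div_pos hη hR0) hq1
    obtain ⟨c, hc, hcg⟩ := hseq j
    refine ⟨_, ⟨_, ⟨c, fun i _ => hc i, rfl⟩, rfl⟩, ?_⟩
    rw [dist_eq_norm]
    exact hcg.trans_lt ((lt_div_iff₀' hR0).1 hj)
  obtain ⟨g', hg', hgg'⟩ := hgP
  rw [← hinj (hPmem hCK hg') hg hgg']
  exact hPmem hCZ hg'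

/-! ### Surjectivity on smooth parts -/

theorem corollary4p2
    {p : ℕ} [Fact p.Prime] {d : ℕ}
    {G : Type*} [Group G] [TopologicalSpace G] [IsTopologicalGroup G]
    [ChartedSpace (Fin d → ℚ_[p]) G] [LieGroup 𝓘(ℚ_[p], Fin d → ℚ_[p]) ω G]
    {k : Type*} [Field k] {m : ℕ} [CharP k m] (hm : 0 < m)
    {V W : Type*} [AddCommGroup V] [Module k V] [AddCommGroup W] [Module k W]
    {ρ : Representation k G V} {σ : Representation k G W}
    (f : Representation.IntertwiningMap ρ σ)
    (hf : Function.Surjective f)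
    (hker : f.ker.toRepresentation.IsSmooth) :
    Function.Surjective f.smoothMap := by
  -- For a topological group this gives the Hausdorff property.
  have : T1Space G := ChartedSpace.t1Space (Fin d → ℚ_[p]) G
  have hG := LieGroup.exists_isOpen_isCompact_subgroup (p := p) (d := d) (G := G)
  rintro ⟨w, hw⟩
  have hw' : w ∈ (σ.smoothPart.toSubmodule : Set W) := hw
  rw [σ.coe_smoothPart hG] at hw'
  simp only [Set.mem_iUnion] at hw'
  obtain ⟨K, ⟨hKo, hKc⟩, hKw⟩ := hw'
  obtain ⟨v, rfl⟩ := hf w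
  have hs : ∀ g ∈ K, IsOpen (ρ.vectorStabilizer (ρ g v - v) : Set G) := by
    intro g hg
    have h0 : ρ g v - v ∈ f.ker.toSubmodule := by
      change f (ρ g v - v) = 0
      rw [map_sub, Representation.IntertwiningMap.isIntertwining, hKw g hg, sub_self]
    convert hker.isOpen_vectorStabilizer ⟨_, h0⟩ using 2
    ext x
    rw [Representation.mem_vectorStabilizer, Representation.mem_vectorStabilizer, Subtype.ext_iff]
    rfl
  have hp : (1 : ℝ) < p := by exact_mod_cast (Fact.out : p.Prime).one_lt
  obtain ⟨ψ, L, r, hr, hLo, hLc, hLK, hL, hcont, hinj, him⟩ :=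
    LieGroup.exists_nearlyAdditive (p := p) (d := d) (G := G) (ε := (p : ℝ)⁻¹ ^ 2)
      (by positivity) (pow_le_one₀ (by positivity) (inv_le_one_of_one_le₀ hp.le))
      (hKo.mem_nhds K.one_mem)
  obtain ⟨R, hR, hRv⟩ := hL.exists_forall_norm_le_mem (Z := ρ.vectorStabilizer v) hr hLc hcont
    hinj him fun x hx => Representation.exists_closure_zpowers_le_vectorStabilizer hm hKc hs (hLK hx)
  have hZ : IsOpen (ρ.vectorStabilizer v : Set G) := by
    refine Subgroup.isOpen_of_mem_nhds _ (g := 1) ?_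
    have h1 : ContinuousAt ψ 1 := hcont.continuousAt (hLo.mem_nhds L.one_mem)
    have h2 : ∀ᶠ g in nhds (1 : G), ψ g ∈ Metric.closedBall 0 R :=
      h1.eventually (by rw [hL.map_one]; exact Metric.closedBall_mem_nhds 0 hR)
    filter_upwards [h2, hLo.mem_nhds L.one_mem] with g hg hgL
    exact hRv g hgL (mem_closedBall_zero_iff.1 hg)
  have hv : v ∈ (ρ.smoothPart.toSubmodule : Set V) := by
    rw [ρ.coe_smoothPart hG]
    simp only [Set.mem_iUnion]
    exact ⟨K ⊓ ρ.vectorStabilizer v, ⟨hKo.inter hZ,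
      hKc.inter_right (Subgroup.isClosed_of_isOpen _ hZ)⟩, fun x hx => hx.2⟩
  exact ⟨⟨v, hv⟩, rfl⟩
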